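/- Let $N\ge 0$, $w\ge 1$ and $0\le h\le N$ be integers. Let $\mathbf n\in\mathbb R^3$ be a unit vector and let $J_{\mathbf n}=\frac12\sum_{i=1}^N \mathbf n\cdot\boldsymbol\sigma^{(i)}$ be the collective spin operator of $N$ qubits, where $\boldsymbol\sigma^{(i)}$ is the vector of Pauli matrices acting on qubit $i$. For a density matrix $\rho=\sum_k\lambda_k|k\rangle\langle k|$ (spectral decomposition) and a Hermitian $H$, the quantum Fisher information is $$F_Q[\rho,H]=2\sum_{k,l:\ \lambda_k+\lambda_l>0}\frac{(\lambda_k-\lambda_l)^2}{\lambda_k+\lambda_l}\,|\langle k|H|l\rangle|^2 .$$ For a partition $\Lambda=\{A_1,\dots,A_m\}$ of the $N$ qubits into nonempty blocks, a state is $\Lambda$-separable if it is a finite convex combination of tensor products $\rho_{A_1}\otimes\cdots\otimes\rho_{A_m}$ of states of the blocks. Let $\mathcal L_{w,h}$ be the set of partitions all of whose blocks have at most $w$ elements and which have at least $h$ blocks. A state is $(w,h)$-separable if it has the form $\sum_{\Lambda\in\mathcal L_{w,h}}P_\Lambda\rho_\Lambda$ with a probability distribution $P$ on $\mathcal L_{w,h}$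 and $\Lambda$-separable states $\rho_\Lambda$. Put $$f_N(w,h)=\max_{\Lambda\in\mathcal L_{w,h}}\ \sum_{A\in\Lambda}|A|^2 .$$ Then the maximum defining $f_N(w,h)$ is taken over a nonempty set, and: 1. Every $(w,h)$-separable state $\rho$ satisfies $F_Q[\rho,J_{\mathbf n}]\le f_N(w,h)$ and $F_Q[\rho,J_{\mathbf n}]\le w(N-h)+N$; moreover $f_N(w,h)\le w(N-h)+N$. 2. The first bound is tight: $\max_{\rho}F_Q[\rho,J_{\mathbf n}]=f_N(w,h)$, the maximum being over all $(w,h)$-separable states $\rho$ and attained. 3. Let $\Lambda\in\mathcal L_{w,h}$ be any partition with $\sum_{A\in\Lambda}|A|^2=f_N(w,h)$. Then products of GHZ states over $\Lambda$ exist, and every such product, i.e. every pure state with vector $$\bigotimes_{A\in\Lambda}\frac{|{\downarrow}\rangle^{\otimes A}+e^{i\phi_A}|{\uparrow}\rangle^{\otimes A}}{\sqrt2},$$ where $|{\uparrow}\rangle,|{\downarrow}\rangle$ are unit eigenvectors of $\mathbf n\cdot\boldsymbol\sigma$ for the eigenvalues $+1,-1$ and $\phi_A\in\mathbb R$ are arbitrary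 phases, is $(w,h)$-separable and has $F_Q[\,\cdot\,,J_{\mathbf n}]=f_N(w,h)$. -/

import Mathlib

open scoped BigOperators Matrix ComplexOrder

noncomputable section

namespace WHSep

/-- A quantum state on a system whose computational basis is the finite type `ι`:
a positive semidefinite complex matrix of trace one. -/
structure DensityMatrix (ι : Type) [Fintype ι] where
  matrix : Matrix ι ι ℂ
  posSemidef : matrix.PosSemidef
  trace_eq_one : matrix.trace = 1

/-- Computational-basis labels of a register of qubits whose sites are indexed by `S`.
The label `0` is the eigenvalue `+1` of `σ_z`, the label `1` is the eigenvalue `-1`. -/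
abbrev Config (S : Type) : Type := S → Fin 2

/-! ### Quantum Fisher information -/

/-- The quantum Fisher information of the state `ρ` for the unitary family
`exp(-iθH) ρ exp(iθH)`: with a spectral decomposition `ρ = ∑ₖ λₖ |k⟩⟨k|`,
`F_Q[ρ,H] = 2 ∑_{k,l : λₖ+λₗ>0} (λₖ-λₗ)² / (λₖ+λₗ) |⟨k|H|l⟩|²`. -/
def qfi {ι : Type} [Fintype ι] [DecidableEq ι] (ρ : DensityMatrix ι) (H : Matrix ι ι ℂ) : ℝ :=
  let ev : ι → ℝ := ρ.posSemidef.isHermitian.eigenvalues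
  let ket : ι → ι → ℂ := fun k => (ρ.posSemidef.isHermitian.eigenvectorBasis k).ofLp
  2 * ∑ k, ∑ l, if 0 < ev k + ev l then
    (ev k - ev l) ^ 2 / (ev k + ev l) * ‖star (ket k) ⬝ᵥ (H *ᵥ ket l)‖ ^ 2 else 0

/-! ### Collective spin -/

/-- The vector `(σ_x, σ_y, σ_z)` of Pauli matrices. -/
def pauli : Fin 3 → Matrix (Fin 2) (Fin 2) ℂ :=
  ![!![0, 1; 1, 0], !![0, -Complex.I; Complex.I, 0], !![1, 0; 0, -1]]

/-- The single-qubit operator `n · σ`. -/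
def pauliDot (n : EuclideanSpace ℝ (Fin 3)) : Matrix (Fin 2) (Fin 2) ℂ :=
  ∑ a, (n a : ℂ) • pauli a

/-- The single-qubit operator `M` acting on the qubit `i` of a register of `N` qubits
(tensored with the identity on all other qubits). -/
def onSite {N : ℕ} (i : Fin N) (M : Matrix (Fin 2) (Fin 2) ℂ) :
    Matrix (Config (Fin N)) (Config (Fin N)) ℂ :=
  fun x y => if ∀ j, j ≠ i → x j = y j then M (x i) (y i) else 0

/-- The collective angular momentum operator `J_n = ∑ᵢ n · σ^{(i)} / 2`. -/
def collectiveSpin (N : ℕ) (n : EuclideanSpace ℝ (Fin 3)) :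
    Matrix (Config (Fin N)) (Config (Fin N)) ℂ :=
  (1 / 2 : ℂ) • ∑ i : Fin N, onSite i (pauliDot n)

/-! ### Partitions and separability -/

/-- Partitions of the set of `N` parties into nonempty disjoint blocks. -/
abbrev Partition (N : ℕ) : Type := Finpartition (Finset.univ : Finset (Fin N))

/-- The partitions whose largest block has at most `w` parties and which have at least
`h` blocks. -/
def classWH (N w h : ℕ) : Finset (Partition N) :=
  {Λ : Partition N | (∀ A ∈ Λ.parts, A.card ≤ w) ∧ h ≤ Λ.parts.card}

/-- The sum of the squared block sizes of a partition. -/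
def sumSq {N : ℕ} (Λ : Partition N) : ℕ := ∑ A ∈ Λ.parts, A.card ^ 2

/-- `f_N(w,h)`: the maximum of the sum of squared block sizes over `classWH N w h`. -/
def fMax (N w h : ℕ) : ℕ := (classWH N w h).sup sumSq

/-- The tensor product of local operators, one for each block of `Λ`. -/
def productMatrix {N : ℕ} (Λ : Partition N)
    (σ : ∀ A : Finset (Fin N), DensityMatrix (Config A)) :
    Matrix (Config (Fin N)) (Config (Fin N)) ℂ :=
  fun x y => ∏ A ∈ Λ.parts, (σ A).matrix (fun i => x i) (fun i => y i)

/-- `Λ`-separable states: convex mixtures of tensor products of states of the blocks of `Λ`. -/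
def IsSeparable {N : ℕ} (Λ : Partition N) (ρ : DensityMatrix (Config (Fin N))) : Prop :=
  ∃ (m : ℕ) (p : Fin m → ℝ) (σ : Fin m → ∀ A : Finset (Fin N), DensityMatrix (Config A)),
    (∀ γ, 0 ≤ p γ) ∧ ∑ γ, p γ = 1 ∧
      ρ.matrix = ∑ γ, (p γ : ℂ) • productMatrix Λ (σ γ)

/-- `(w,h)`-separable states: convex mixtures of `Λ`-separable states, where `Λ` ranges over
the partitions with all blocks of size at most `w` and with at least `h` blocks. -/
def IsWHSeparable {N : ℕ} (w h : ℕ) (ρ : DensityMatrix (Config (Fin N))) : Prop :=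
  ∃ (P : Partition N → ℝ) (R : Partition N → DensityMatrix (Config (Fin N))),
    (∀ Λ ∈ classWH N w h, 0 ≤ P Λ) ∧ ∑ Λ ∈ classWH N w h, P Λ = 1 ∧
      (∀ Λ ∈ classWH N w h, IsSeparable Λ (R Λ)) ∧
        ρ.matrix = ∑ Λ ∈ classWH N w h, (P Λ : ℂ) • (R Λ).matrix

/-! ### Products of GHZ states -/

/-- The GHZ vector `(|↓⟩^{⊗A} + e^{iφ} |↑⟩^{⊗A}) / √2` on the block `A`. -/
def ghz {N : ℕ} (down up : Fin 2 → ℂ) (φ : ℝ) (A : Finset (Fin N)) : Config A → ℂ :=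
  fun x => ((∏ i, down (x i)) + Complex.exp (Complex.I * φ) * (∏ i, up (x i))) / (√2 : ℝ)

/-- The product over the blocks `A` of `Λ` of the GHZ vectors with phases `φ A`. -/
def ghzProduct {N : ℕ} (down up : Fin 2 → ℂ) (φ : Finset (Fin N) → ℝ) (Λ : Partition N) :
    Config (Fin N) → ℂ :=
  fun x => ∏ A ∈ Λ.parts, ghz down up (φ A) A (fun i => x i)

/-- `ρ` is the pure state given by a product, over the blocks of `Λ`, of GHZ states in the
direction `n`: `|↑⟩` and `|↓⟩` are unit eigenvectors of `n · σ` with eigenvalues `+1`, `-1`. -/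
def IsGHZProduct {N : ℕ} (n : EuclideanSpace ℝ (Fin 3)) (Λ : Partition N)
    (ρ : DensityMatrix (Config (Fin N))) : Prop :=
  ∃ (down up : Fin 2 → ℂ) (φ : Finset (Fin N) → ℝ),
    star down ⬝ᵥ down = 1 ∧ star up ⬝ᵥ up = 1 ∧
      pauliDot n *ᵥ down = -down ∧ pauliDot n *ᵥ up = up ∧
        ρ.matrix = Matrix.vecMulVec (ghzProduct down up φ Λ) (star (ghzProduct down up φ Λ))

end WHSep

end

/-!
Let `L` be a symmetric logarithmic derivative of `exp(-iθH) ρ exp(iθH)` at `ρ`. The operator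
`2i[H, L] - L²` has expectation `F_Q[ρ, H]` in the state `ρ`, and completing the square shows that
its expectation in any state is at most four times the variance of `H` there. Expectations being
affine in the state, `F_Q[ρ, H]` is at most the maximum of `4 Var(H)` over the product states of
which `ρ` is a mixture. In a product state over `Λ` the variance of `2 J_n` is the sum of the
variances in the blocks, and a block `A` contributes at most `|A|²`, because `2 J_n` is there a sum
of `|A|` Hermitian involutions. The superposition of the eigenvalues `±|A|` in a GHZ state reaches
`|A|²`, and for pure states `F_Q = 4 Var`. Finally `|A|² ≤ w (|A| - 1) + |A|` if
`1 ≤ |A| ≤ w`, which summed over at least `h` blocks gives `w (N - h) + N`.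
-/

namespace WHSep

open Matrix

section Variance

variable {ι : Type} [Fintype ι]

@[ext]
theorem DensityMatrix.ext {ρ τ : DensityMatrix ι} (h : ρ.matrix = τ.matrix) : ρ = τ := by
  cases ρ; cases τ; congr

/-- The expectation value `Tr(ρA)` of the operator `A` in the state `ρ`. -/
noncomputable def expectation (ρ : DensityMatrix ι) : Matrix ι ι ℂ →ₗ[ℂ] ℂ :=
  traceLinearMap ι ℂ ℂ ∘ₗ LinearMap.mulLeft ℂ ρ.matrix

theorem expectation_apply (ρ : DensityMatrix ι) (A : Matrix ι ι ℂ) :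
    expectation ρ A = (ρ.matrix * A).trace := rfl

theorem expectation_one [DecidableEq ι] (ρ : DensityMatrix ι) : expectation ρ 1 = 1 := by
  rw [expectation_apply, Matrix.mul_one, ρ.trace_eq_one]

theorem expectation_conjTranspose (ρ : DensityMatrix ι) (A : Matrix ι ι ℂ) :
    expectation ρ Aᴴ = star (expectation ρ A) := by
  rw [expectation_apply, expectation_apply, ← trace_conjTranspose, conjTranspose_mul,
    ρ.posSemidef.isHermitian.eq, Matrix.trace_mul_comm]

theorem expectation_conjTranspose_mul_self_nonneg (ρ : DensityMatrix ι) (A : Matrix ι ι ℂ) :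
    0 ≤ expectation ρ (Aᴴ * A) := by
  rw [expectation_apply, ← Matrix.mul_assoc, Matrix.trace_mul_comm, ← Matrix.mul_assoc]
  exact (ρ.posSemidef.mul_mul_conjTranspose_same A).trace_nonneg

theorem expectation_sq_nonneg (ρ : DensityMatrix ι) {A : Matrix ι ι ℂ} (hA : A.IsHermitian) :
    0 ≤ expectation ρ A ^ 2 := by
  have hreal : star (expectation ρ A) = expectation ρ A := by
    rw [← expectation_conjTranspose, hA.eq]
  calc 0 ≤ star (expectation ρ A) * expectation ρ A := star_mul_self_nonneg _
    _ = expectation ρ A ^ 2 := by rw [hreal, sq]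

/-- The variance `⟨A²⟩ - ⟨A⟩²` of `A` in the state `ρ`. It is complex-valued so that it is additive
over tensor factors for arbitrary operators; for Hermitian `A` it is real, and it is compared with
real numbers in the partial order of `ℂ`. -/
noncomputable def variance (ρ : DensityMatrix ι) (A : Matrix ι ι ℂ) : ℂ :=
  expectation ρ (A * A) - expectation ρ A ^ 2

theorem variance_smul (ρ : DensityMatrix ι) (c : ℂ) (A : Matrix ι ι ℂ) :
    variance ρ (c • A) = c ^ 2 * variance ρ A := by
  simp only [variance, Matrix.smul_mul, Matrix.mul_smul, map_smul, smul_eq_mul]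
  ring

theorem variance_eq_expectation_sub_mul_sub [DecidableEq ι] (ρ : DensityMatrix ι)
    (A : Matrix ι ι ℂ) :
    variance ρ A =
      expectation ρ ((A - expectation ρ A • 1) * (A - expectation ρ A • 1)) := by
  simp only [variance, Matrix.sub_mul, Matrix.mul_sub, Matrix.smul_mul, Matrix.mul_smul,
    Matrix.one_mul, Matrix.mul_one, map_sub, map_smul, expectation_one, smul_eq_mul]
  ring

theorem variance_le_expectation_mul_self (ρ : DensityMatrix ι) {A : Matrix ι ι ℂ}
    (hA : A.IsHermitian) : variance ρ A ≤ expectation ρ (A * A) :=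
  sub_le_self _ (expectation_sq_nonneg ρ hA)

theorem expectation_sum_mul_sum_le (ρ : DensityMatrix ι) {α : Type*} (s : Finset α)
    {A : α → Matrix ι ι ℂ} (hA : ∀ i ∈ s, (A i).IsHermitian) :
    expectation ρ ((∑ i ∈ s, A i) * ∑ i ∈ s, A i) ≤
      s.card * ∑ i ∈ s, expectation ρ (A i * A i) := by
  have hdiff : 0 ≤ ∑ i ∈ s, ∑ j ∈ s, expectation ρ ((A i - A j) * (A i - A j)) := by
    refine Finset.sum_nonneg fun i hi => Finset.sum_nonneg fun j hj => ?_
    simpa only [((hA i hi).sub (hA j hj)).eq] using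
      expectation_conjTranspose_mul_self_nonneg ρ (A i - A j)
  have hexpand : ∑ i ∈ s, ∑ j ∈ s, expectation ρ ((A i - A j) * (A i - A j)) =
      2 * (s.card * ∑ i ∈ s, expectation ρ (A i * A i) -
        expectation ρ ((∑ i ∈ s, A i) * ∑ i ∈ s, A i)) := by
    have hcomm : ∑ i ∈ s, ∑ j ∈ s, expectation ρ (A j * A i) =
        ∑ i ∈ s, ∑ j ∈ s, expectation ρ (A i * A j) := Finset.sum_comm
    simp only [Matrix.sub_mul, Matrix.mul_sub, map_sub, Finset.sum_sub_distrib, hcomm,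
      Finset.sum_mul_sum, map_sum, Finset.sum_const, nsmul_eq_mul]
    rw [← Finset.mul_sum]
    ring
  rw [hexpand] at hdiff
  refine sub_nonneg.mp ?_
  simpa using mul_nonneg (inv_nonneg.mpr (zero_le_two (α := ℂ))) hdiff

/-- A rank-one density matrix. -/
noncomputable def pureState (ψ : ι → ℂ) (hψ : star ψ ⬝ᵥ ψ = 1) : DensityMatrix ι where
  matrix := vecMulVec ψ (star ψ)
  posSemidef := posSemidef_vecMulVec_self_star ψ
  trace_eq_one := by rw [trace_vecMulVec, dotProduct_comm, hψ]

theorem expectation_pureState {ψ : ι → ℂ} (hψ : star ψ ⬝ᵥ ψ = 1) (A : Matrix ι ι ℂ) :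
    expectation (pureState ψ hψ) A = star ψ ⬝ᵥ (A *ᵥ ψ) := by
  rw [expectation_apply, pureState, Matrix.trace_mul_comm, mul_vecMulVec, trace_vecMulVec,
    dotProduct_comm]

theorem pureState_mul_mul_pureState {ψ : ι → ℂ} (hψ : star ψ ⬝ᵥ ψ = 1) (A : Matrix ι ι ℂ) :
    (pureState ψ hψ).matrix * A * (pureState ψ hψ).matrix =
      expectation (pureState ψ hψ) A • (pureState ψ hψ).matrix := by
  rw [expectation_pureState, pureState, vecMulVec_mul, vecMulVec_mul_vecMulVec,
    dotProduct_mulVec, vecMulVec_smul]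

end Variance

section QuantumFisherInformation

variable {ι : Type} [Fintype ι]

/-- `L` is a symmetric logarithmic derivative at `ρ` of the unitary family `exp(-iθH) ρ exp(iθH)`,
whose derivative is `i[ρ, H]`; the equation below is twice the usual `{ρ, L} / 2 = i[ρ, H]`. -/
structure IsSymmLogDeriv (ρ : DensityMatrix ι) (H L : Matrix ι ι ℂ) : Prop where
  isHermitian : L.IsHermitian
  mul_add_mul : ρ.matrix * L + L * ρ.matrix =
    (2 * Complex.I) • (ρ.matrix * H - H * ρ.matrix)

theorem IsSymmLogDeriv.expectation_mul_self {ρ : DensityMatrix ι} {H L : Matrix ι ι ℂ}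
    (hL : IsSymmLogDeriv ρ H L) :
    expectation ρ (L * L) = Complex.I * expectation ρ (H * L - L * H) := by
  have h := congrArg (fun X => (X * L).trace) hL.mul_add_mul
  simp only [Matrix.add_mul, Matrix.sub_mul, Matrix.smul_mul, trace_add, trace_sub, trace_smul,
    smul_eq_mul, Matrix.mul_assoc, Matrix.trace_mul_comm L, Matrix.trace_mul_comm H] at h
  simp only [map_sub, expectation_apply]
  linear_combination h / 2

section Eigenbasis

variable [DecidableEq ι]

/-- The eigenvalues that `qfi` uses. -/
noncomputable abbrev DensityMatrix.eigenvalues (ρ : DensityMatrix ι) : ι → ℝ :=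
  ρ.posSemidef.isHermitian.eigenvalues

/-- The change of basis `A ↦ U⋆ A U` to an orthonormal eigenbasis of `ρ`, namely the one that
`qfi` uses. -/
noncomputable def toEigenbasis (ρ : DensityMatrix ι) : Matrix ι ι ℂ ≃⋆ₐ[ℂ] Matrix ι ι ℂ :=
  Unitary.conjStarAlgAut ℂ _ (star ρ.posSemidef.isHermitian.eigenvectorUnitary)

theorem toEigenbasis_apply_apply (ρ : DensityMatrix ι) (A : Matrix ι ι ℂ) (k l : ι) :
    toEigenbasis ρ A k l =
      star (ρ.posSemidef.isHermitian.eigenvectorBasis k).ofLp ⬝ᵥ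
        (A *ᵥ (ρ.posSemidef.isHermitian.eigenvectorBasis l).ofLp) := by
  rw [toEigenbasis, Unitary.conjStarAlgAut_star_apply, Matrix.mul_assoc, Matrix.mul_apply]
  rfl

theorem toEigenbasis_self (ρ : DensityMatrix ι) :
    toEigenbasis ρ ρ.matrix = diagonal fun k => (ρ.eigenvalues k : ℂ) :=
  ρ.posSemidef.isHermitian.conjStarAlgAut_star_eigenvectorUnitary

theorem trace_toEigenbasis (ρ : DensityMatrix ι) (A : Matrix ι ι ℂ) :
    (toEigenbasis ρ A).trace = A.trace := by
  rw [toEigenbasis, Unitary.conjStarAlgAut_star_apply, Matrix.trace_mul_comm, ← Matrix.mul_assoc,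
    Unitary.mul_star_self_of_mem (SetLike.coe_mem _), Matrix.one_mul]

theorem isHermitian_toEigenbasis_iff (ρ : DensityMatrix ι) {A : Matrix ι ι ℂ} :
    (toEigenbasis ρ A).IsHermitian ↔ A.IsHermitian := by
  rw [Matrix.IsHermitian, ← star_eq_conjTranspose, ← map_star,
    (EquivLike.injective (toEigenbasis ρ)).eq_iff, star_eq_conjTranspose, Matrix.IsHermitian]

end Eigenbasis

theorem exists_isSymmLogDeriv (ρ : DensityMatrix ι) {H : Matrix ι ι ℂ} (hH : H.IsHermitian) :
    ∃ L, IsSymmLogDeriv ρ H L := by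
  classical
  set T := toEigenbasis ρ
  -- If both eigenvalues vanish, the quotient is `0` and so is the right-hand side of the equation.
  set c : ι → ι → ℝ := fun k l =>
    (ρ.eigenvalues k - ρ.eigenvalues l) / (ρ.eigenvalues k + ρ.eigenvalues l)
  obtain ⟨L, hL⟩ := EquivLike.surjective T
    (Matrix.of fun k l => 2 * Complex.I * (c k l : ℂ) * T H k l)
  have hc_swap (k l : ι) : c l k = -c k l := by
    simp only [c]
    rw [← neg_div, neg_sub, add_comm]
  have hc_mul (k l : ι) : c k l * (ρ.eigenvalues k + ρ.eigenvalues l) =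
      ρ.eigenvalues k - ρ.eigenvalues l := by
    refine div_mul_cancel_of_imp fun h => ?_
    have hk := ρ.posSemidef.eigenvalues_nonneg k
    have hl := ρ.posSemidef.eigenvalues_nonneg l
    linarith
  refine ⟨L, (isHermitian_toEigenbasis_iff ρ).mp ?_, EquivLike.injective T ?_⟩
  · ext k l
    have hT := ((isHermitian_toEigenbasis_iff ρ).mpr hH).apply k l
    change star (T L l k) = T L k l
    simp only [hL, of_apply, star_mul', hT, T, hc_swap k l, Complex.star_def, Complex.ofReal_neg,
      Complex.conj_I, map_ofNat, map_neg, Complex.conj_ofReal]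
    ring
  · ext k l
    have h : (c k l : ℂ) * (ρ.eigenvalues k + ρ.eigenvalues l) =
        ρ.eigenvalues k - ρ.eigenvalues l := mod_cast hc_mul k l
    simp only [map_add, map_mul, map_sub, map_smul, T, toEigenbasis_self, Matrix.add_apply,
      Matrix.sub_apply, Matrix.smul_apply, diagonal_mul, mul_diagonal, smul_eq_mul]
    simp only [T] at hL
    simp only [hL, of_apply]
    linear_combination 2 * Complex.I * toEigenbasis ρ H k l * h

variable [DecidableEq ι]

theorem IsSymmLogDeriv.eigenvalues_add_mul {ρ : DensityMatrix ι} {H L : Matrix ι ι ℂ}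
    (hL : IsSymmLogDeriv ρ H L) (k l : ι) :
    ((ρ.eigenvalues k + ρ.eigenvalues l : ℝ) : ℂ) * toEigenbasis ρ L k l =
      2 * Complex.I * (ρ.eigenvalues k - ρ.eigenvalues l : ℝ) * toEigenbasis ρ H k l := by
  have h := congrFun₂ (congrArg (toEigenbasis ρ) hL.mul_add_mul) k l
  simp only [map_add, map_mul, map_sub, map_smul, toEigenbasis_self, Matrix.add_apply,
    Matrix.sub_apply, Matrix.smul_apply, diagonal_mul, mul_diagonal, smul_eq_mul] at h
  push_cast
  linear_combination h

theorem expectation_mul_self_eq_sum (ρ : DensityMatrix ι) {A : Matrix ι ι ℂ}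
    (hA : A.IsHermitian) :
    expectation ρ (A * A) =
      ((∑ k, ∑ l, ρ.eigenvalues k * ‖toEigenbasis ρ A k l‖ ^ 2 : ℝ) : ℂ) := by
  have hnorm (k l : ι) : toEigenbasis ρ A k l * toEigenbasis ρ A l k =
      (‖toEigenbasis ρ A k l‖ : ℂ) ^ 2 := by
    rw [← ((isHermitian_toEigenbasis_iff ρ).mpr hA).apply l k, Complex.star_def, Complex.mul_conj']
  rw [expectation_apply, ← trace_toEigenbasis ρ]
  push_cast
  simp only [map_mul, toEigenbasis_self, Matrix.trace, Matrix.diag, diagonal_mul]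
  simp only [Matrix.mul_apply, Finset.mul_sum, hnorm]

theorem IsSymmLogDeriv.qfi_eq {ρ : DensityMatrix ι} {H L : Matrix ι ι ℂ}
    (hL : IsSymmLogDeriv ρ H L) : (qfi ρ H : ℂ) = expectation ρ (L * L) := by
  set ev := ρ.eigenvalues
  set a : ι → ι → ℝ := fun k l => ‖toEigenbasis ρ L k l‖ ^ 2
  have ha_symm (k l : ι) : a k l = a l k := by
    simp only [a]
    rw [← ((isHermitian_toEigenbasis_iff ρ).mpr hL.isHermitian).apply k l, norm_star]
  have hterm (k l : ι) : (if 0 < ev k + ev l then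
      (ev k - ev l) ^ 2 / (ev k + ev l) * ‖toEigenbasis ρ H k l‖ ^ 2 else 0) =
        (ev k + ev l) * a k l / 4 := by
    have h : ((ev k + ev l) ^ 2 * a k l : ℝ) =
        4 * (ev k - ev l) ^ 2 * ‖toEigenbasis ρ H k l‖ ^ 2 := by
      have := congrArg (‖·‖ ^ 2) (hL.eigenvalues_add_mul k l)
      simp only [norm_mul, Complex.norm_real, mul_pow, Real.norm_eq_abs, sq_abs, Complex.norm_I,
        Complex.norm_ofNat] at this
      linarith
    split_ifs with hpos
    · field_simp
      linarith
    · have hzero : ev k + ev l = 0 := le_antisymm (not_lt.mp hpos)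
        (add_nonneg (ρ.posSemidef.eigenvalues_nonneg k) (ρ.posSemidef.eigenvalues_nonneg l))
      rw [hzero, zero_mul, zero_div]
  have hsymm : ∑ k, ∑ l, ev l * a k l = ∑ k, ∑ l, ev k * a k l := by
    rw [Finset.sum_comm]
    simp only [ha_symm]
  rw [expectation_mul_self_eq_sum ρ hL.isHermitian, Complex.ofReal_inj]
  calc qfi ρ H = 2 * ∑ k, ∑ l, (ev k + ev l) * a k l / 4 := by
        simp only [← hterm, toEigenbasis_apply_apply, qfi, ev]
    _ = ∑ k, ∑ l, ev k * a k l := by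
        simp only [add_mul, ← Finset.sum_div, Finset.sum_add_distrib, hsymm]
        ring

/-- The operator `G` is `2i[H, L] - L²`, for `L` a symmetric logarithmic derivative at `ρ`: with
`M = 2i(H - ⟨H⟩)`, the expectation of `(L + M)ᴴ (L + M)` is the difference of the two sides. -/
theorem exists_qfi_eq_expectation_and_le_variance (ρ : DensityMatrix ι) {H : Matrix ι ι ℂ}
    (hH : H.IsHermitian) :
    ∃ G : Matrix ι ι ℂ, (qfi ρ H : ℂ) = expectation ρ G ∧
      ∀ τ : DensityMatrix ι, expectation τ G ≤ 4 * variance τ H := by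
  obtain ⟨L, hL⟩ := exists_isSymmLogDeriv ρ hH
  refine ⟨(2 * Complex.I) • (H * L - L * H) - L * L, ?_, fun τ => ?_⟩
  · rw [map_sub, map_smul, smul_eq_mul, mul_assoc, ← hL.expectation_mul_self, hL.qfi_eq]
    ring
  · set M := (2 * Complex.I) • (H - expectation τ H • (1 : Matrix ι ι ℂ)) with hM
    have hM_skew : Mᴴ = -M := by
      simp only [hM, conjTranspose_smul, conjTranspose_sub, conjTranspose_one, hH.eq,
        ← expectation_conjTranspose, star_mul', Complex.star_def, map_ofNat, Complex.conj_I,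
        mul_neg, neg_smul]
    have hcomm : (2 * Complex.I) • (H * L - L * H) = M * L - L * M := by
      simp only [hM, Matrix.smul_mul, Matrix.mul_smul, Matrix.sub_mul, Matrix.mul_sub,
        Matrix.one_mul, Matrix.mul_one, ← smul_sub, sub_sub_sub_cancel_right]
    have hvar : expectation τ (M * M) = -(4 * variance τ H) := by
      rw [variance_eq_expectation_sub_mul_sub]
      simp only [hM, Matrix.smul_mul, Matrix.mul_smul, map_smul, smul_eq_mul]
      linear_combination 4 * expectation τ ((H - expectation τ H • (1 : Matrix ι ι ℂ)) *
        (H - expectation τ H • (1 : Matrix ι ι ℂ))) * Complex.I_mul_I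
    have hpos := expectation_conjTranspose_mul_self_nonneg τ (L + M)
    have hexpand : (L + M)ᴴ * (L + M) = L * L - (M * L - L * M) - M * M := by
      rw [conjTranspose_add, hL.isHermitian.eq, hM_skew]
      noncomm_ring
    rw [hexpand, map_sub, map_sub, hvar] at hpos
    rw [hcomm, map_sub, ← sub_nonneg]
    linear_combination hpos

theorem qfi_le_of_mem_convexHull {ρ : DensityMatrix ι} {H : Matrix ι ι ℂ} (hH : H.IsHermitian)
    {b : ℝ} {E : Set (DensityMatrix ι)} (hE : ∀ τ ∈ E, 4 * variance τ H ≤ b)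
    (hρ : ρ.matrix ∈ convexHull ℝ (DensityMatrix.matrix '' E)) : qfi ρ H ≤ b := by
  obtain ⟨G, hG, hle⟩ := exists_qfi_eq_expectation_and_le_variance ρ hH
  have hlin : IsLinearMap ℝ fun X : Matrix ι ι ℂ => (X * G).trace := by
    constructor <;> intros <;> simp [Matrix.add_mul]
  have hsub : DensityMatrix.matrix '' E ⊆ {X | (X * G).trace ≤ b} := by
    rintro _ ⟨τ, hτ, rfl⟩
    exact (hle τ).trans (hE τ hτ)
  have hmean : (ρ.matrix * G).trace ≤ b :=
    convexHull_min hsub (convex_halfSpace_le hlin (b : ℂ)) hρ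
  rwa [← expectation_apply, ← hG, Complex.real_le_real] at hmean

/-- For a pure state, `2i[ρ, H]` is a symmetric logarithmic derivative. -/
theorem qfi_pureState {ψ : ι → ℂ} (hψ : star ψ ⬝ᵥ ψ = 1) {H : Matrix ι ι ℂ}
    (hH : H.IsHermitian) : (qfi (pureState ψ hψ) H : ℂ) = 4 * variance (pureState ψ hψ) H := by
  set ρ := pureState ψ hψ
  have hidem : ρ.matrix * ρ.matrix = ρ.matrix := by
    simpa only [Matrix.mul_one, expectation_one, one_smul] using pureState_mul_mul_pureState hψ 1
  have hL : IsSymmLogDeriv ρ H ((2 * Complex.I) • (ρ.matrix * H - H * ρ.matrix)) := by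
    constructor
    · simp only [Matrix.IsHermitian, conjTranspose_smul, conjTranspose_sub, conjTranspose_mul,
        hH.eq, ρ.posSemidef.isHermitian.eq, star_mul', Complex.star_def, map_ofNat,
        Complex.conj_I, mul_neg, neg_smul, ← smul_neg, neg_sub]
    · simp only [Matrix.mul_smul, Matrix.smul_mul, ← smul_add, Matrix.mul_sub, Matrix.sub_mul,
        ← Matrix.mul_assoc, hidem]
      rw [Matrix.mul_assoc H, hidem, sub_add_sub_cancel]
  have hHρH : expectation ρ (H * ρ.matrix * H) = expectation ρ H ^ 2 := by
    rw [expectation_apply, ← Matrix.mul_assoc, ← Matrix.mul_assoc, pureState_mul_mul_pureState,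
      Matrix.smul_mul, trace_smul, smul_eq_mul, ← expectation_apply, sq]
  have hρHH : expectation ρ (ρ.matrix * H * H) = expectation ρ (H * H) := by
    rw [expectation_apply, ← Matrix.mul_assoc, ← Matrix.mul_assoc, hidem, Matrix.mul_assoc,
      expectation_apply]
  have hHHρ : expectation ρ (H * (H * ρ.matrix)) = expectation ρ (H * H) := by
    rw [expectation_apply, Matrix.trace_mul_comm, Matrix.mul_assoc, Matrix.mul_assoc, hidem,
      ← Matrix.mul_assoc, Matrix.trace_mul_comm, expectation_apply]
  rw [hL.qfi_eq, hL.expectation_mul_self]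
  simp only [Matrix.mul_smul, Matrix.smul_mul, ← smul_sub, map_smul, Matrix.mul_sub,
    Matrix.sub_mul, map_sub, ← Matrix.mul_assoc, variance, smul_eq_mul] at hHρH hρHH hHHρ ⊢
  rw [hHρH, hρHH, hHHρ]
  linear_combination (-4 * (expectation ρ (H * H) - expectation ρ H ^ 2)) * Complex.I_mul_I

end QuantumFisherInformation

section TensorProduct

variable {κ : Type} [Fintype κ] [DecidableEq κ] {X : κ → Type} [∀ k, Fintype (X k)]

/-- The tensor product of vectors. -/
def piVec (v : ∀ k, X k → ℂ) : (∀ k, X k) → ℂ := fun x => ∏ k, v k (x k)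

theorem star_piVec_dotProduct_piVec (u v : ∀ k, X k → ℂ) :
    star (piVec u) ⬝ᵥ piVec v = ∏ k, star (u k) ⬝ᵥ v k := by
  simp only [dotProduct, piVec, Pi.star_apply, star_prod, ← Finset.prod_mul_distrib,
    Finset.prod_univ_sum, Fintype.piFinset_univ]

variable [∀ k, DecidableEq (X k)]

/-- The tensor product `⨂ₖ A k`, as a matrix on the product of the index types. -/
def piTensor : (∀ k, Matrix (X k) (X k) ℂ) →* Matrix (∀ k, X k) (∀ k, X k) ℂ where
  toFun A := of fun x y => ∏ k, A k (x k) (y k)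
  map_one' := by
    ext x y
    simp only [of_apply, Pi.one_apply, one_apply, Finset.prod_ite_zero, Finset.prod_const_one,
      Finset.mem_univ, true_imp_iff, funext_iff]
  map_mul' A B := by
    ext x y
    simp only [of_apply, Pi.mul_apply, mul_apply, Finset.prod_univ_sum, Fintype.piFinset_univ,
      Finset.prod_mul_distrib]

theorem piTensor_apply (A : ∀ k, Matrix (X k) (X k) ℂ) (x y : ∀ k, X k) :
    piTensor A x y = ∏ k, A k (x k) (y k) := rfl

theorem conjTranspose_piTensor (A : ∀ k, Matrix (X k) (X k) ℂ) :
    (piTensor A)ᴴ = piTensor fun k => (A k)ᴴ := by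
  ext x y
  simp only [conjTranspose_apply, piTensor_apply, star_prod]

theorem trace_piTensor (A : ∀ k, Matrix (X k) (X k) ℂ) :
    (piTensor A).trace = ∏ k, (A k).trace := by
  simp only [trace, diag_apply, piTensor_apply, Finset.prod_univ_sum, Fintype.piFinset_univ]

open scoped MatrixOrder Matrix.Norms.L2Operator in
theorem posSemidef_piTensor {A : ∀ k, Matrix (X k) (X k) ℂ} (hA : ∀ k, (A k).PosSemidef) :
    (piTensor A).PosSemidef := by
  choose B hB using fun k => CStarAlgebra.nonneg_iff_eq_star_mul_self.mp (hA k).nonneg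
  have hAB : A = (fun k => (B k)ᴴ) * B := funext hB
  rw [hAB, map_mul, ← conjTranspose_piTensor]
  exact posSemidef_conjTranspose_mul_self _

/-- The product state `⨂ₖ ρ k`. -/
noncomputable def DensityMatrix.pi (ρ : ∀ k, DensityMatrix (X k)) : DensityMatrix (∀ k, X k) where
  matrix := piTensor fun k => (ρ k).matrix
  posSemidef := posSemidef_piTensor fun k => (ρ k).posSemidef
  trace_eq_one := by simp only [trace_piTensor, trace_eq_one, Finset.prod_const_one]

theorem expectation_pi_piTensor (ρ : ∀ k, DensityMatrix (X k)) (A : ∀ k, Matrix (X k) (X k) ℂ) :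
    expectation (.pi ρ) (piTensor A) = ∏ k, expectation (ρ k) (A k) := by
  simp only [expectation_apply, DensityMatrix.pi, ← map_mul, trace_piTensor, Pi.mul_apply]

theorem piTensor_mulSingle_apply (k : κ) (A : Matrix (X k) (X k) ℂ) (x y : ∀ k, X k) :
    piTensor (Pi.mulSingle k A) x y =
      if ∀ j, j ≠ k → x j = y j then A (x k) (y k) else 0 := by
  have hother : ∏ j ∈ Finset.univ.erase k,
      (Pi.mulSingle k A : ∀ j, Matrix (X j) (X j) ℂ) j (x j) (y j) =
      ∏ j ∈ Finset.univ.erase k, if x j = y j then (1 : ℂ) else 0 :=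
    Finset.prod_congr rfl fun j hj => by
      rw [Pi.mulSingle_eq_of_ne (Finset.ne_of_mem_erase hj), one_apply]
  rw [piTensor_apply, ← Finset.mul_prod_erase _ _ (Finset.mem_univ k), hother, Pi.mulSingle_eq_same,
    Finset.prod_ite_zero, Finset.prod_const_one, mul_ite, mul_one, mul_zero]
  simp only [Finset.mem_erase, Finset.mem_univ, and_true]

/-- The operator `A` acting on the tensor factor `k`, and the identity on all others. -/
def localOp (k : κ) : Matrix (X k) (X k) ℂ →⋆ₐ[ℂ] Matrix (∀ k, X k) (∀ k, X k) ℂ where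
  toFun A := piTensor (Pi.mulSingle k A)
  map_one' := by rw [Pi.mulSingle_one, map_one]
  map_mul' A B := by rw [Pi.mulSingle_mul, map_mul]
  map_zero' := by
    ext x y
    simp only [piTensor_mulSingle_apply, Matrix.zero_apply, ite_self]
  map_add' A B := by
    ext x y
    simp only [piTensor_mulSingle_apply, Matrix.add_apply, ← ite_add_zero]
  commutes' c := by
    ext x y
    simp only [piTensor_mulSingle_apply, algebraMap_matrix_apply, ← ite_and, funext_iff]
    congr 1
    grind
  map_star' A := by
    rw [star_eq_conjTranspose, star_eq_conjTranspose, conjTranspose_piTensor]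
    congr 1
    ext1 j
    obtain rfl | hj := eq_or_ne j k
    · simp only [Pi.mulSingle_eq_same]
    · simp only [Pi.mulSingle_eq_of_ne hj, conjTranspose_one]

theorem localOp_apply (k : κ) (A : Matrix (X k) (X k) ℂ) :
    localOp k A = piTensor (Pi.mulSingle k A) := rfl

theorem expectation_pi_localOp (ρ : ∀ k, DensityMatrix (X k)) (k : κ)
    (A : Matrix (X k) (X k) ℂ) : expectation (.pi ρ) (localOp k A) = expectation (ρ k) A := by
  rw [localOp_apply, expectation_pi_piTensor, Fintype.prod_eq_single k, Pi.mulSingle_eq_same]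
  intro j hj
  rw [Pi.mulSingle_eq_of_ne hj, expectation_one]

theorem expectation_pi_localOp_mul_localOp (ρ : ∀ k, DensityMatrix (X k)) {j k : κ} (hjk : j ≠ k)
    (A : Matrix (X j) (X j) ℂ) (B : Matrix (X k) (X k) ℂ) :
    expectation (.pi ρ) (localOp j A * localOp k B) =
      expectation (ρ j) A * expectation (ρ k) B := by
  rw [localOp_apply, localOp_apply, ← map_mul, expectation_pi_piTensor,
    Fintype.prod_eq_mul j k hjk]
  · simp only [Pi.mul_apply, Pi.mulSingle_eq_same, Pi.mulSingle_eq_of_ne hjk,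
      Pi.mulSingle_eq_of_ne hjk.symm, Matrix.mul_one, Matrix.one_mul]
  · rintro i ⟨hij, hik⟩
    rw [Pi.mul_apply, Pi.mulSingle_eq_of_ne hij, Pi.mulSingle_eq_of_ne hik, Matrix.mul_one,
      expectation_one]

theorem variance_pi_sum_localOp (ρ : ∀ k, DensityMatrix (X k)) (A : ∀ k, Matrix (X k) (X k) ℂ) :
    variance (.pi ρ) (∑ k, localOp k (A k)) = ∑ k, variance (ρ k) (A k) := by
  have hcov (j k : κ) : expectation (.pi ρ) (localOp j (A j) * localOp k (A k)) =
      expectation (ρ j) (A j) * expectation (ρ k) (A k) +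
        if j = k then variance (ρ k) (A k) else 0 := by
    split_ifs with hjk
    · subst hjk
      rw [← map_mul, expectation_pi_localOp, variance]
      ring
    · rw [expectation_pi_localOp_mul_localOp ρ hjk, add_zero]
  rw [variance, Finset.sum_mul_sum]
  simp only [map_sum, hcov, expectation_pi_localOp, Finset.sum_add_distrib, sq,
    Finset.sum_mul_sum, Finset.sum_ite_eq, Finset.mem_univ, if_true, add_sub_cancel_left]

theorem piTensor_mulVec_piVec (A : ∀ k, Matrix (X k) (X k) ℂ) (v : ∀ k, X k → ℂ) :
    piTensor A *ᵥ piVec v = piVec fun k => A k *ᵥ v k := by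
  ext x
  simp only [mulVec, dotProduct, piVec, piTensor_apply, ← Finset.prod_mul_distrib,
    Finset.prod_univ_sum, Fintype.piFinset_univ]

theorem localOp_mulVec_piVec {k : κ} {A : Matrix (X k) (X k) ℂ} {v : ∀ k, X k → ℂ} {c : ℂ}
    (hv : A *ᵥ v k = c • v k) : localOp k A *ᵥ piVec v = c • piVec v := by
  have hfactor (j : κ) : (Pi.mulSingle k A : ∀ j, Matrix (X j) (X j) ℂ) j *ᵥ v j =
      (Pi.mulSingle k c : κ → ℂ) j • v j := by
    obtain rfl | hj := eq_or_ne j k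
    · simp only [Pi.mulSingle_eq_same, hv]
    · simp only [Pi.mulSingle_eq_of_ne hj, one_mulVec, one_smul]
  rw [localOp_apply, piTensor_mulVec_piVec]
  ext x
  simp only [hfactor, piVec, Pi.smul_apply, smul_eq_mul, Finset.prod_mul_distrib,
    Finset.prod_pi_mulSingle', Finset.mem_univ, if_true]

end TensorProduct

section Reindex

variable {ι κ : Type} [Fintype ι] [Fintype κ]

/-- The state `ρ` with its computational basis relabelled along `e`. -/
def DensityMatrix.reindex (e : ι ≃ κ) (ρ : DensityMatrix ι) : DensityMatrix κ where
  matrix := Matrix.reindex e e ρ.matrix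
  posSemidef := ρ.posSemidef.submatrix e.symm
  trace_eq_one := by rw [← ρ.trace_eq_one]; exact Equiv.sum_comp e.symm fun i => ρ.matrix i i

theorem expectation_reindex (e : ι ≃ κ) (ρ : DensityMatrix ι) (A : Matrix ι ι ℂ) :
    expectation (ρ.reindex e) (Matrix.reindex e e A) = expectation ρ A := by
  simp only [expectation_apply, DensityMatrix.reindex, reindex_apply, submatrix_mul_equiv]
  exact Equiv.sum_comp e.symm fun i => (ρ.matrix * A) i i

theorem variance_reindex (e : ι ≃ κ) (ρ : DensityMatrix ι) (A : Matrix ι ι ℂ) :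
    variance (ρ.reindex e) (Matrix.reindex e e A) = variance ρ A := by
  rw [variance, variance, ← expectation_reindex e ρ (A * A), ← expectation_reindex e ρ A,
    reindex_apply, reindex_apply, submatrix_mul_equiv]

end Reindex

section Spin

theorem pauliDot_eq (n : EuclideanSpace ℝ (Fin 3)) :
    pauliDot n = !![(n 2 : ℂ), n 0 - n 1 * Complex.I; n 0 + n 1 * Complex.I, -n 2] := by
  ext i j
  fin_cases i <;> fin_cases j <;>
    simp [pauliDot, pauli, Fin.sum_univ_three, Matrix.add_apply, sub_eq_add_neg]

theorem isHermitian_pauliDot (n : EuclideanSpace ℝ (Fin 3)) : (pauliDot n).IsHermitian := by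
  rw [pauliDot_eq]
  ext i j
  fin_cases i <;> fin_cases j <;> simp [sub_eq_add_neg]

theorem trace_pauliDot (n : EuclideanSpace ℝ (Fin 3)) : (pauliDot n).trace = 0 := by
  rw [pauliDot_eq, trace_fin_two_of, add_neg_cancel]

theorem pauliDot_mul_self {n : EuclideanSpace ℝ (Fin 3)} (hn : ‖n‖ = 1) :
    pauliDot n * pauliDot n = 1 := by
  have hnorm : (n 0 : ℂ) ^ 2 + (n 1 : ℂ) ^ 2 + (n 2 : ℂ) ^ 2 = 1 := by
    have h := EuclideanSpace.real_norm_sq_eq n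
    rw [hn, Fin.sum_univ_three, one_pow] at h
    exact_mod_cast h.symm
  rw [pauliDot_eq, mul_fin_two, one_fin_two]
  congr!
  · linear_combination hnorm - (n 1 : ℂ) ^ 2 * Complex.I_sq
  · ring
  · ring
  · linear_combination hnorm - (n 1 : ℂ) ^ 2 * Complex.I_sq

variable {S : Type} [Fintype S] [DecidableEq S]

/-- The operator `M` acting on the qubit `i`: `onSite` for an arbitrary finite register. -/
abbrev qubitOp (i : S) : Matrix (Fin 2) (Fin 2) ℂ →⋆ₐ[ℂ] Matrix (Config S) (Config S) ℂ :=
  localOp (X := fun _ => Fin 2) i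

/-- The sum `∑ᵢ n · σ^{(i)}` over the qubits `S`, that is, twice their collective spin. -/
noncomputable def spinSum (S : Type) [Fintype S] [DecidableEq S] (n : EuclideanSpace ℝ (Fin 3)) :
    Matrix (Config S) (Config S) ℂ :=
  ∑ i : S, qubitOp i (pauliDot n)

theorem isHermitian_qubitOp_pauliDot (i : S) (n : EuclideanSpace ℝ (Fin 3)) :
    (qubitOp i (pauliDot n)).IsHermitian :=
  ((isHermitian_pauliDot n).isSelfAdjoint.map (qubitOp i)).isHermitian

theorem isHermitian_spinSum (n : EuclideanSpace ℝ (Fin 3)) : (spinSum S n).IsHermitian :=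
  (isSelfAdjoint_sum _ fun i _ => (isHermitian_qubitOp_pauliDot i n).isSelfAdjoint).isHermitian

theorem variance_spinSum_le {n : EuclideanSpace ℝ (Fin 3)} (hn : ‖n‖ = 1)
    (ρ : DensityMatrix (Config S)) : variance ρ (spinSum S n) ≤ Fintype.card S ^ 2 :=
  calc variance ρ (spinSum S n) ≤ expectation ρ (spinSum S n * spinSum S n) :=
        variance_le_expectation_mul_self ρ (isHermitian_spinSum n)
    _ ≤ Fintype.card S * ∑ i : S,
          expectation ρ (qubitOp i (pauliDot n) * qubitOp i (pauliDot n)) :=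
        expectation_sum_mul_sum_le ρ _ fun i _ => isHermitian_qubitOp_pauliDot i n
    _ = Fintype.card S ^ 2 := by
        simp only [← map_mul, pauliDot_mul_self hn, map_one, expectation_one, Finset.sum_const,
          Finset.card_univ, nsmul_eq_mul, mul_one, sq]

theorem spinSum_mulVec_piVec {n : EuclideanSpace ℝ (Fin 3)} {v : Fin 2 → ℂ} {c : ℂ}
    (hv : pauliDot n *ᵥ v = c • v) :
    spinSum S n *ᵥ piVec (fun _ : S => v) = (Fintype.card S * c) • piVec fun _ : S => v := by
  simp only [spinSum, sum_mulVec, localOp_mulVec_piVec (v := fun _ : S => v) hv, Finset.sum_const,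
    Finset.card_univ, ← Nat.cast_smul_eq_nsmul ℂ, smul_smul]

theorem onSite_eq_qubitOp {N : ℕ} (i : Fin N) (M : Matrix (Fin 2) (Fin 2) ℂ) :
    onSite i M = qubitOp i M := by
  ext x y
  rw [localOp_apply, piTensor_mulSingle_apply, onSite]
  congr

theorem collectiveSpin_eq_smul_spinSum (N : ℕ) (n : EuclideanSpace ℝ (Fin 3)) :
    collectiveSpin N n = (1 / 2 : ℂ) • spinSum (Fin N) n := by
  simp only [collectiveSpin, spinSum, onSite_eq_qubitOp]

theorem isHermitian_collectiveSpin (N : ℕ) (n : EuclideanSpace ℝ (Fin 3)) :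
    (collectiveSpin N n).IsHermitian := by
  rw [collectiveSpin_eq_smul_spinSum, Matrix.IsHermitian, conjTranspose_smul,
    (isHermitian_spinSum n).eq]
  simp

theorem four_mul_variance_collectiveSpin {N : ℕ} (ρ : DensityMatrix (Config (Fin N)))
    (n : EuclideanSpace ℝ (Fin 3)) :
    4 * variance ρ (collectiveSpin N n) = variance ρ (spinSum (Fin N) n) := by
  rw [collectiveSpin_eq_smul_spinSum, variance_smul]
  ring

end Spin

section Blocks

variable {N : ℕ} (Λ : Partition N)

/-- The decomposition of the register into the blocks of `Λ`. -/
def siteEquiv : Fin N ≃ Σ A : Λ.parts, A.1 :=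
  (Equiv.subtypeUnivEquiv Finset.mem_univ).symm.trans Λ.equivSigmaParts

/-- The resulting identification of the configurations of the register with families of
configurations of the blocks. -/
def configEquiv : Config (Fin N) ≃ ∀ A : Λ.parts, Config A :=
  ((siteEquiv Λ).arrowCongr (Equiv.refl (Fin 2))).trans (Equiv.piCurry fun _ _ => Fin 2)

theorem configEquiv_apply (x : Config (Fin N)) (A : Λ.parts) :
    configEquiv Λ x A = fun i : A.1 => x i := rfl

/-- The product state `⨂_{A ∈ Λ} σ A`. Only the values of `σ` at the blocks of `Λ` enter. -/
noncomputable def productState (σ : ∀ A : Finset (Fin N), DensityMatrix (Config A)) :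
    DensityMatrix (Config (Fin N)) :=
  (DensityMatrix.pi fun A : Λ.parts => σ A).reindex (configEquiv Λ).symm

theorem productState_matrix (σ : ∀ A : Finset (Fin N), DensityMatrix (Config A)) :
    (productState Λ σ).matrix = productMatrix Λ σ := by
  ext x y
  exact Finset.prod_coe_sort Λ.parts fun A => (σ A).matrix (fun i => x i) fun i => y i

theorem reindex_localOp_qubitOp (A : Λ.parts) (i : A.1) (M : Matrix (Fin 2) (Fin 2) ℂ) :
    Matrix.reindex (configEquiv Λ).symm (configEquiv Λ).symm
      (localOp (X := fun A : Λ.parts => Config A) A (qubitOp i M)) = qubitOp (i : Fin N) M := by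
  have hiff (x y : Config (Fin N)) : (∀ j, j ≠ (i : Fin N) → x j = y j) ↔
      (∀ B, B ≠ A → configEquiv Λ x B = configEquiv Λ y B) ∧
        ∀ j, j ≠ i → configEquiv Λ x A j = configEquiv Λ y A j := by
    simp only [configEquiv_apply, funext_iff]
    refine ⟨fun h => ⟨fun B hBA j => h j ?_, fun j hj => h j ?_⟩, fun ⟨hB, hA⟩ j hj => ?_⟩
    · rintro hji
      exact hBA (Subtype.ext (Λ.eq_of_mem_parts B.2 A.2 j.2 (hji ▸ i.2)))
    · exact Subtype.coe_ne_coe.mpr hj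
    · obtain ⟨B, hBΛ, hjB⟩ := Λ.exists_mem (Finset.mem_univ j)
      obtain rfl | hBA := eq_or_ne (⟨B, hBΛ⟩ : Λ.parts) A
      · exact hA ⟨j, hjB⟩ (Subtype.coe_ne_coe.mp hj)
      · exact hB ⟨B, hBΛ⟩ hBA ⟨j, hjB⟩
  ext x y
  simp only [reindex_apply, submatrix_apply, Equiv.symm_symm, localOp_apply,
    piTensor_mulSingle_apply, hiff, ite_and]
  rfl

theorem spinSum_eq_reindex_sum (n : EuclideanSpace ℝ (Fin 3)) :
    spinSum (Fin N) n = Matrix.reindex (configEquiv Λ).symm (configEquiv Λ).symm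
      (∑ A : Λ.parts, localOp A (spinSum A n)) := by
  calc spinSum (Fin N) n = ∑ p : Σ A : Λ.parts, A.1, qubitOp (p.2 : Fin N) (pauliDot n) :=
        (siteEquiv Λ).sum_comp fun p => qubitOp (p.2 : Fin N) (pauliDot n)
    _ = ∑ A : Λ.parts, ∑ i : A.1, qubitOp (i : Fin N) (pauliDot n) := Fintype.sum_sigma _
    _ = _ := by
        simp only [← reindex_localOp_qubitOp Λ, spinSum, map_sum]
        simp only [← Matrix.coe_reindexLinearEquiv ℂ ℂ, map_sum]

theorem variance_productState_spinSum (σ : ∀ A : Finset (Fin N), DensityMatrix (Config A))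
    (n : EuclideanSpace ℝ (Fin 3)) :
    variance (productState Λ σ) (spinSum (Fin N) n) =
      ∑ A ∈ Λ.parts, variance (σ A) (spinSum A n) := by
  rw [spinSum_eq_reindex_sum Λ, productState, variance_reindex, variance_pi_sum_localOp]
  exact Finset.sum_coe_sort Λ.parts fun A => variance (σ A) (spinSum A n)

end Blocks

section Separability

variable {N : ℕ} {w h : ℕ}

instance instNonemptyDensityMatrix {ι : Type} [Fintype ι] [Nonempty ι] :
    Nonempty (DensityMatrix ι) := by
  classical
  obtain ⟨i⟩ := ‹Nonempty ι›
  exact ⟨pureState (Pi.single i 1) (by simp)⟩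

theorem isSeparable_productState (Λ : Partition N)
    (σ : ∀ A : Finset (Fin N), DensityMatrix (Config A)) : IsSeparable Λ (productState Λ σ) := by
  refine ⟨1, 1, fun _ => σ, fun _ => zero_le_one, Fintype.sum_unique _, ?_⟩
  rw [Fintype.sum_unique, productState_matrix, Pi.one_apply, Complex.ofReal_one, one_smul]

theorem IsSeparable.isWHSeparable {Λ : Partition N} {ρ : DensityMatrix (Config (Fin N))}
    (hρ : IsSeparable Λ ρ) (hΛ : Λ ∈ classWH N w h) : IsWHSeparable w h ρ := by
  let R : Partition N → DensityMatrix (Config (Fin N)) := Function.update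
    (fun Λ' => productState Λ' fun _ => Classical.arbitrary _) Λ ρ
  refine ⟨Pi.single Λ 1, R, fun Λ' _ => ?_, ?_, fun Λ' _ => ?_, ?_⟩
  · exact (Pi.single_nonneg (α := fun _ => ℝ)).mpr zero_le_one Λ'
  · rw [Finset.sum_pi_single', if_pos hΛ]
  · obtain rfl | hne := eq_or_ne Λ' Λ
    · simpa only [R, Function.update_self] using hρ
    · simpa only [R, Function.update_of_ne hne] using isSeparable_productState Λ' _
  · rw [Finset.sum_eq_single_of_mem Λ hΛ fun Λ' _ hne => by
      rw [Pi.single_eq_of_ne hne, Complex.ofReal_zero, zero_smul]]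
    simp only [R, Function.update_self, Pi.single_eq_same, Complex.ofReal_one, one_smul]

theorem IsSeparable.mem_convexHull {Λ : Partition N} {ρ : DensityMatrix (Config (Fin N))}
    (hρ : IsSeparable Λ ρ) :
    ρ.matrix ∈ convexHull ℝ (DensityMatrix.matrix '' Set.range (productState Λ)) := by
  obtain ⟨m, p, σ, hp, hp_sum, hρ⟩ := hρ
  simp only [hρ, ← productState_matrix, Complex.coe_smul]
  exact (convex_convexHull ℝ _).sum_mem (fun γ _ => hp γ) hp_sum fun γ _ =>
    subset_convexHull ℝ _ (Set.mem_image_of_mem _ (Set.mem_range_self _))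

theorem IsWHSeparable.mem_convexHull {ρ : DensityMatrix (Config (Fin N))}
    (hρ : IsWHSeparable w h ρ) :
    ρ.matrix ∈ convexHull ℝ
      (DensityMatrix.matrix '' ⋃ Λ ∈ classWH N w h, Set.range (productState Λ)) := by
  obtain ⟨P, R, hP, hP_sum, hR, hρ⟩ := hρ
  simp only [hρ, Complex.coe_smul]
  refine (convex_convexHull ℝ _).sum_mem hP hP_sum fun Λ hΛ => ?_
  refine convexHull_mono (Set.image_mono ?_) (hR Λ hΛ).mem_convexHull
  exact Set.subset_biUnion_of_mem (u := fun Λ => Set.range (productState Λ)) hΛ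

theorem variance_productState_spinSum_le {n : EuclideanSpace ℝ (Fin 3)} (hn : ‖n‖ = 1)
    (Λ : Partition N) (σ : ∀ A : Finset (Fin N), DensityMatrix (Config A)) :
    variance (productState Λ σ) (spinSum (Fin N) n) ≤ sumSq Λ := by
  rw [variance_productState_spinSum, sumSq, Nat.cast_sum]
  refine Finset.sum_le_sum fun A _ => ?_
  simpa only [Fintype.card_coe, Nat.cast_pow] using variance_spinSum_le hn (σ A)

theorem IsWHSeparable.qfi_le_fMax {n : EuclideanSpace ℝ (Fin 3)} (hn : ‖n‖ = 1)
    {ρ : DensityMatrix (Config (Fin N))} (hρ : IsWHSeparable w h ρ) :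
    qfi ρ (collectiveSpin N n) ≤ fMax N w h := by
  refine qfi_le_of_mem_convexHull (isHermitian_collectiveSpin N n) ?_ hρ.mem_convexHull
  simp only [Set.mem_iUnion, Set.mem_range]
  rintro _ ⟨Λ, hΛ, σ, rfl⟩
  calc 4 * variance (productState Λ σ) (collectiveSpin N n) ≤ sumSq Λ := by
        rw [four_mul_variance_collectiveSpin]
        exact variance_productState_spinSum_le hn Λ σ
    _ ≤ ((fMax N w h : ℝ) : ℂ) := mod_cast Finset.le_sup (f := sumSq) hΛ

end Separability

section GHZ

theorem exists_unit_vec_mulVec_eq_self {ι : Type} [Fintype ι] [DecidableEq ι] {M : Matrix ι ι ℂ}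
    (hM : M * M = 1) (hM_ne : M ≠ -1) : ∃ v : ι → ℂ, star v ⬝ᵥ v = 1 ∧ M *ᵥ v = v := by
  obtain ⟨u, hu⟩ : ∃ u, (M + 1) *ᵥ u ≠ 0 := by
    by_contra! hzero
    refine hM_ne (eq_neg_of_add_eq_zero_left (Matrix.ext_of_mulVec_single fun i => ?_))
    rw [hzero, zero_mulVec]
  set v := WithLp.toLp 2 ((M + 1) *ᵥ u) with hv
  have hv_ne : ‖v‖ ≠ 0 := norm_ne_zero_iff.mpr ((WithLp.toLp_eq_zero 2).not.mpr hu)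
  have hv_fixed : M *ᵥ v.ofLp = v.ofLp := by
    rw [hv, mulVec_mulVec, Matrix.mul_add, hM, Matrix.mul_one, add_comm]
  refine ⟨((‖v‖⁻¹ : ℝ) : ℂ) • v.ofLp, ?_, by rw [mulVec_smul, hv_fixed]⟩
  have hv_norm : star v.ofLp ⬝ᵥ v.ofLp = (‖v‖ : ℂ) ^ 2 := by
    rw [dotProduct_comm, ← EuclideanSpace.inner_eq_star_dotProduct]
    exact inner_self_eq_norm_sq_to_K v
  rw [star_smul, smul_dotProduct, dotProduct_smul, hv_norm, Complex.star_def, Complex.conj_ofReal,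
    smul_eq_mul, smul_eq_mul, Complex.ofReal_inv]
  have : (‖v‖ : ℂ) ≠ 0 := mod_cast hv_ne
  field_simp

variable {n : EuclideanSpace ℝ (Fin 3)} {d u : Fin 2 → ℂ}

theorem exists_unit_eigenvectors_pauliDot (hn : ‖n‖ = 1) :
    ∃ d u : Fin 2 → ℂ, star d ⬝ᵥ d = 1 ∧ star u ⬝ᵥ u = 1 ∧
      pauliDot n *ᵥ d = -d ∧ pauliDot n *ᵥ u = u := by
  have hne {M : Matrix (Fin 2) (Fin 2) ℂ} (hM : M.trace = 0) : M ≠ -1 := by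
    rintro rfl
    simp at hM
  obtain ⟨u, hu, hu_eigen⟩ := exists_unit_vec_mulVec_eq_self (pauliDot_mul_self hn)
    (hne (trace_pauliDot n))
  obtain ⟨d, hd, hd_eigen⟩ := exists_unit_vec_mulVec_eq_self (M := -pauliDot n)
    (by rw [neg_mul_neg, pauliDot_mul_self hn]) (hne (by rw [trace_neg, trace_pauliDot, neg_zero]))
  exact ⟨d, u, hd, hu, by rw [← neg_eq_iff_eq_neg, ← neg_mulVec, hd_eigen], hu_eigen⟩

theorem star_dotProduct_eq_zero_of_mulVec_eq {ι : Type} [Fintype ι] {M : Matrix ι ι ℂ}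
    (hM : M.IsHermitian) {u v : ι → ℂ} (hu : M *ᵥ u = -u) (hv : M *ᵥ v = v) :
    star u ⬝ᵥ v = 0 := by
  have h : star (M *ᵥ u) ⬝ᵥ v = star u ⬝ᵥ (M *ᵥ v) := by
    rw [star_mulVec, hM.eq, dotProduct_mulVec]
  rw [hu, hv, star_neg, neg_dotProduct] at h
  exact self_eq_neg.mp h.symm

variable {N : ℕ}

theorem ghz_eq_smul_piVec_add (d u : Fin 2 → ℂ) (φ : ℝ) (A : Finset (Fin N)) :
    ghz d u φ A = ((√2 : ℝ) : ℂ)⁻¹ •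
      (piVec (fun _ : A => d) + Complex.exp (Complex.I * φ) • piVec fun _ : A => u) := by
  ext x
  simp only [ghz, piVec, Pi.smul_apply, Pi.add_apply, smul_eq_mul, div_eq_inv_mul]

theorem star_ghz_dotProduct_mulVec_ghz (hd : star d ⬝ᵥ d = 1) (hu : star u ⬝ᵥ u = 1)
    (hdu : star d ⬝ᵥ u = 0) (φ : ℝ) {A : Finset (Fin N)} (hA : A.Nonempty)
    {M : Matrix (Config A) (Config A) ℂ} {a b : ℂ}
    (hMd : M *ᵥ piVec (fun _ : A => d) = a • piVec fun _ : A => d)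
    (hMu : M *ᵥ piVec (fun _ : A => u) = b • piVec fun _ : A => u) :
    star (ghz d u φ A) ⬝ᵥ (M *ᵥ ghz d u φ A) = (a + b) / 2 := by
  have hA_card : Fintype.card A ≠ 0 := by rwa [Fintype.card_coe, Finset.card_ne_zero]
  have hud : star u ⬝ᵥ d = 0 := by rw [star_dotProduct, hdu, star_zero]
  have hphase : star (Complex.exp (Complex.I * φ)) * Complex.exp (Complex.I * φ) = 1 := by
    rw [Complex.star_def, ← Complex.exp_conj, ← Complex.exp_add]
    simp
  have hhalf : star ((√2 : ℝ) : ℂ)⁻¹ * ((√2 : ℝ) : ℂ)⁻¹ = 1 / 2 := by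
    rw [star_inv₀, Complex.star_def, Complex.conj_ofReal, ← mul_inv, ← Complex.ofReal_mul,
      Real.mul_self_sqrt zero_le_two, one_div, Complex.ofReal_ofNat]
  simp only [ghz_eq_smul_piVec_add, mulVec_smul, mulVec_add, hMd, hMu, star_smul, star_add,
    smul_dotProduct, dotProduct_smul, add_dotProduct, dotProduct_add, star_piVec_dotProduct_piVec,
    hd, hu, hdu, hud, Finset.prod_const, Finset.card_univ, one_pow, zero_pow hA_card, smul_eq_mul]
  linear_combination (a + b) * hhalf +
    star ((√2 : ℝ) : ℂ)⁻¹ * ((√2 : ℝ) : ℂ)⁻¹ * b * hphase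

theorem star_ghz_dotProduct_ghz (hd : star d ⬝ᵥ d = 1) (hu : star u ⬝ᵥ u = 1)
    (hdu : star d ⬝ᵥ u = 0) (φ : ℝ) {A : Finset (Fin N)} (hA : A.Nonempty) :
    star (ghz d u φ A) ⬝ᵥ ghz d u φ A = 1 := by
  simpa using star_ghz_dotProduct_mulVec_ghz hd hu hdu φ hA (M := 1) (a := 1) (b := 1)
    (by simp) (by simp)

theorem variance_pureState_ghz (hd : star d ⬝ᵥ d = 1) (hu : star u ⬝ᵥ u = 1)
    (hMd : pauliDot n *ᵥ d = -d) (hMu : pauliDot n *ᵥ u = u) (φ : ℝ)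
    {A : Finset (Fin N)} (hA : A.Nonempty) (hψ : star (ghz d u φ A) ⬝ᵥ ghz d u φ A = 1) :
    variance (pureState (ghz d u φ A) hψ) (spinSum A n) = A.card ^ 2 := by
  have hdu := star_dotProduct_eq_zero_of_mulVec_eq (isHermitian_pauliDot n) hMd hMu
  have hJd := spinSum_mulVec_piVec (S := A) (n := n) (v := d) (c := -1) (by rw [hMd, neg_one_smul])
  have hJu := spinSum_mulVec_piVec (S := A) (n := n) (v := u) (c := 1) (by rw [hMu, one_smul])
  have hmean : expectation (pureState _ hψ) (spinSum A n) = 0 := by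
    rw [expectation_pureState, star_ghz_dotProduct_mulVec_ghz hd hu hdu φ hA hJd hJu]
    ring
  have hsquare : expectation (pureState _ hψ) (spinSum A n * spinSum A n) = A.card ^ 2 := by
    have hJJd : (spinSum A n * spinSum A n) *ᵥ piVec (fun _ : A => d) =
        (A.card ^ 2 : ℂ) • piVec fun _ : A => d := by
      rw [← mulVec_mulVec, hJd, mulVec_smul, hJd, smul_smul, Fintype.card_coe]
      ring_nf
    have hJJu : (spinSum A n * spinSum A n) *ᵥ piVec (fun _ : A => u) =
        (A.card ^ 2 : ℂ) • piVec fun _ : A => u := by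
      rw [← mulVec_mulVec, hJu, mulVec_smul, hJu, smul_smul, Fintype.card_coe]
      ring_nf
    rw [expectation_pureState, star_ghz_dotProduct_mulVec_ghz hd hu hdu φ hA hJJd hJJu]
    ring
  rw [variance, hmean, hsquare]
  ring

theorem exists_eq_pureState_ghz (hd : star d ⬝ᵥ d = 1) (hu : star u ⬝ᵥ u = 1)
    (hdu : star d ⬝ᵥ u = 0) (φ : Finset (Fin N) → ℝ) :
    ∃ σ : ∀ A : Finset (Fin N), DensityMatrix (Config A), ∀ (A) (hA : A.Nonempty),
      σ A = pureState (ghz d u (φ A) A) (star_ghz_dotProduct_ghz hd hu hdu (φ A) hA) := by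
  classical
  -- Both branches of `ghz` are the scalar `1` at `∅`, so `ghz` need not be a unit vector there.
  exact ⟨fun A => if hA : A.Nonempty then
    pureState _ (star_ghz_dotProduct_ghz hd hu hdu (φ A) hA) else Classical.arbitrary _,
    fun A hA => dif_pos hA⟩

theorem vecMulVec_ghzProduct (φ : Finset (Fin N) → ℝ) (Λ : Partition N)
    {σ : ∀ A : Finset (Fin N), DensityMatrix (Config A)}
    (hσ : ∀ A ∈ Λ.parts,
      (σ A).matrix = vecMulVec (ghz d u (φ A) A) (star (ghz d u (φ A) A))) :
    vecMulVec (ghzProduct d u φ Λ) (star (ghzProduct d u φ Λ)) = productMatrix Λ σ := by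
  ext x y
  rw [vecMulVec_apply, Pi.star_apply, ghzProduct, ghzProduct, star_prod,
    ← Finset.prod_mul_distrib, productMatrix]
  refine Finset.prod_congr rfl fun A hA => ?_
  rw [hσ A hA, vecMulVec_apply, Pi.star_apply]

theorem exists_isGHZProduct (hn : ‖n‖ = 1) (Λ : Partition N) :
    ∃ ρ : DensityMatrix (Config (Fin N)), IsGHZProduct n Λ ρ := by
  obtain ⟨d, u, hd, hu, hMd, hMu⟩ := exists_unit_eigenvectors_pauliDot hn
  have hdu := star_dotProduct_eq_zero_of_mulVec_eq (isHermitian_pauliDot n) hMd hMu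
  obtain ⟨σ, hσ⟩ := exists_eq_pureState_ghz (N := N) hd hu hdu 0
  refine ⟨productState Λ σ, d, u, 0, hd, hu, hMd, hMu, ?_⟩
  rw [productState_matrix]
  refine (vecMulVec_ghzProduct 0 Λ fun A hA => ?_).symm
  rw [hσ A (Λ.nonempty_of_mem_parts hA), pureState]

theorem IsGHZProduct.exists_eq_productState {Λ : Partition N}
    {ρ : DensityMatrix (Config (Fin N))} (hρ : IsGHZProduct n Λ ρ) :
    ∃ σ : ∀ A : Finset (Fin N), DensityMatrix (Config A), ρ = productState Λ σ ∧
      ∀ A ∈ Λ.parts, variance (σ A) (spinSum A n) = A.card ^ 2 := by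
  obtain ⟨d, u, φ, hd, hu, hMd, hMu, hρ⟩ := hρ
  have hdu := star_dotProduct_eq_zero_of_mulVec_eq (isHermitian_pauliDot n) hMd hMu
  obtain ⟨σ, hσ⟩ := exists_eq_pureState_ghz hd hu hdu φ
  refine ⟨σ, DensityMatrix.ext ?_, fun A hA => ?_⟩
  · rw [hρ, productState_matrix]
    refine vecMulVec_ghzProduct φ Λ fun A hA => ?_
    rw [hσ A (Λ.nonempty_of_mem_parts hA), pureState]
  · rw [hσ A (Λ.nonempty_of_mem_parts hA)]
    exact variance_pureState_ghz hd hu hMd hMu (φ A) (Λ.nonempty_of_mem_parts hA) _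

theorem IsGHZProduct.isSeparable {Λ : Partition N} {ρ : DensityMatrix (Config (Fin N))}
    (hρ : IsGHZProduct n Λ ρ) : IsSeparable Λ ρ := by
  obtain ⟨σ, rfl, _⟩ := hρ.exists_eq_productState
  exact isSeparable_productState Λ σ

theorem IsGHZProduct.exists_eq_pureState {Λ : Partition N} {ρ : DensityMatrix (Config (Fin N))}
    (hρ : IsGHZProduct n Λ ρ) : ∃ ψ hψ, ρ = pureState ψ hψ := by
  obtain ⟨d, u, φ, -, -, -, -, hρ⟩ := hρ
  have hunit : star (ghzProduct d u φ Λ) ⬝ᵥ ghzProduct d u φ Λ = 1 := by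
    rw [dotProduct_comm, ← trace_vecMulVec, ← hρ, ρ.trace_eq_one]
  exact ⟨_, hunit, DensityMatrix.ext hρ⟩

theorem IsGHZProduct.qfi_eq {Λ : Partition N} {ρ : DensityMatrix (Config (Fin N))}
    (hρ : IsGHZProduct n Λ ρ) : qfi ρ (collectiveSpin N n) = sumSq Λ := by
  have hqfi : (qfi ρ (collectiveSpin N n) : ℂ) = 4 * variance ρ (collectiveSpin N n) := by
    obtain ⟨ψ, hψ, rfl⟩ := hρ.exists_eq_pureState
    exact qfi_pureState hψ (isHermitian_collectiveSpin N n)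
  obtain ⟨σ, rfl, hσ⟩ := hρ.exists_eq_productState
  rw [four_mul_variance_collectiveSpin, variance_productState_spinSum,
    Finset.sum_congr rfl hσ] at hqfi
  exact_mod_cast hqfi

end GHZ

section Combinatorics

variable {N w h : ℕ}

theorem sumSq_le {Λ : Partition N} (hΛ : Λ ∈ classWH N w h) :
    (sumSq Λ : ℝ) ≤ (w : ℝ) * ((N : ℝ) - h) + N := by
  obtain ⟨hw, hh⟩ := (Finset.mem_filter.mp hΛ).2
  have hcard : ∑ A ∈ Λ.parts, (A.card : ℝ) = N := by
    rw [← Nat.cast_sum, Λ.sum_card_parts, Finset.card_univ, Fintype.card_fin]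
  have hblock (A : Finset (Fin N)) (hA : A ∈ Λ.parts) :
      (A.card : ℝ) ^ 2 ≤ w * (A.card - 1) + A.card := by
    have hpos : (1 : ℝ) ≤ A.card := mod_cast (Λ.nonempty_of_mem_parts hA).card_pos
    have hle : (A.card : ℝ) ≤ w := mod_cast hw A hA
    nlinarith
  calc (sumSq Λ : ℝ) = ∑ A ∈ Λ.parts, (A.card : ℝ) ^ 2 := mod_cast rfl
    _ ≤ ∑ A ∈ Λ.parts, ((w : ℝ) * (A.card - 1) + A.card) := Finset.sum_le_sum hblock
    _ = w * (N - Λ.parts.card) + N := by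
        rw [Finset.sum_add_distrib, ← Finset.mul_sum, Finset.sum_sub_distrib, hcard,
          Finset.sum_const, nsmul_one]
    _ ≤ w * (N - h) + N := by gcongr

theorem bot_mem_classWH (hw : 1 ≤ w) (hh : h ≤ N) : (⊥ : Partition N) ∈ classWH N w h := by
  refine Finset.mem_filter.mpr ⟨Finset.mem_univ _, fun A hA => ?_, ?_⟩
  · obtain ⟨i, _, rfl⟩ := Finpartition.mem_bot_iff.mp hA
    rwa [Finset.card_singleton]
  · rwa [Finpartition.card_bot, Finset.card_univ, Fintype.card_fin]

theorem exists_sumSq_eq_fMax (hw : 1 ≤ w) (hh : h ≤ N) :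
    ∃ Λ ∈ classWH N w h, sumSq Λ = fMax N w h := by
  obtain ⟨Λ, hΛ, hmax⟩ := Finset.exists_mem_eq_sup _ ⟨_, bot_mem_classWH hw hh⟩ (sumSq (N := N))
  exact ⟨Λ, hΛ, hmax.symm⟩

end Combinatorics

end WHSep

theorem mainTheorem1 (N w h : ℕ) (hw : 1 ≤ w) (hh : h ≤ N)
    (n : EuclideanSpace ℝ (Fin 3)) (hn : ‖n‖ = 1) :
    (∀ ρ : WHSep.DensityMatrix (WHSep.Config (Fin N)), WHSep.IsWHSeparable w h ρ →
        WHSep.qfi ρ (WHSep.collectiveSpin N n) ≤ (WHSep.fMax N w h : ℝ) ∧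
        WHSep.qfi ρ (WHSep.collectiveSpin N n) ≤ (w : ℝ) * ((N : ℝ) - (h : ℝ)) + (N : ℝ)) ∧
    (WHSep.fMax N w h : ℝ) ≤ (w : ℝ) * ((N : ℝ) - (h : ℝ)) + (N : ℝ) ∧
    IsGreatest {F : ℝ | ∃ ρ : WHSep.DensityMatrix (WHSep.Config (Fin N)),
        WHSep.IsWHSeparable w h ρ ∧ WHSep.qfi ρ (WHSep.collectiveSpin N n) = F}
      (WHSep.fMax N w h : ℝ) ∧
    (∃ Λ ∈ WHSep.classWH N w h, WHSep.sumSq Λ = WHSep.fMax N w h) ∧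
    (∀ Λ ∈ WHSep.classWH N w h, WHSep.sumSq Λ = WHSep.fMax N w h →
        (∃ ρ : WHSep.DensityMatrix (WHSep.Config (Fin N)), WHSep.IsGHZProduct n Λ ρ) ∧
        ∀ ρ : WHSep.DensityMatrix (WHSep.Config (Fin N)), WHSep.IsGHZProduct n Λ ρ →
          WHSep.IsWHSeparable w h ρ ∧
          WHSep.qfi ρ (WHSep.collectiveSpin N n) = (WHSep.fMax N w h : ℝ)) := by
  obtain ⟨Λ, hΛ, hmax⟩ := WHSep.exists_sumSq_eq_fMax hw hh
  have hf : (WHSep.fMax N w h : ℝ) ≤ (w : ℝ) * ((N : ℝ) - (h : ℝ)) + (N : ℝ) :=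
    hmax ▸ WHSep.sumSq_le hΛ
  have hGHZ {Λ' : WHSep.Partition N} (hΛ' : Λ' ∈ WHSep.classWH N w h)
      (hmax' : WHSep.sumSq Λ' = WHSep.fMax N w h) {ρ : WHSep.DensityMatrix (WHSep.Config (Fin N))}
      (hρ : WHSep.IsGHZProduct n Λ' ρ) : WHSep.IsWHSeparable w h ρ ∧
        WHSep.qfi ρ (WHSep.collectiveSpin N n) = WHSep.fMax N w h :=
    ⟨hρ.isSeparable.isWHSeparable hΛ', by rw [hρ.qfi_eq, hmax']⟩
  refine ⟨fun ρ hρ => ⟨hρ.qfi_le_fMax hn, (hρ.qfi_le_fMax hn).trans hf⟩, hf, ⟨?_, ?_⟩,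
    ⟨Λ, hΛ, hmax⟩, fun Λ' hΛ' hmax' => ⟨WHSep.exists_isGHZProduct hn Λ', fun _ => hGHZ hΛ' hmax'⟩⟩
  · obtain ⟨ρ, hρ⟩ := WHSep.exists_isGHZProduct hn Λ
    exact ⟨ρ, hGHZ hΛ hmax hρ⟩
  · rintro F ⟨ρ, hρ, rfl⟩
    exact hρ.qfi_le_fMax hn
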